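/- An involution $*$ on a ring $R$ is called \emph{formally real} if every (nonempty) finite sum of nonzero elements of the form $rr^*$, $r\in R$, is nonzero. Let $F=\mathbb{C}(a,b)$ be the field of complex rational functions in two variables, let $\epsilon=\frac{-1+i\sqrt3}{2}$, and let $D_3=A_\epsilon(a,b;F)$ be the symbol algebra, i.e. the $F$-algebra with generators $x,y$ and relations $x^3=a$, $y^3=b$, $yx=\epsilon xy$. Let $*$ be the involution on $D_3$ that fixes $a,b,x,y$ and conjugates the elements of $\mathbb{C}$, and let $K=F(x)\subseteq D_3$, which is $*$-invariant. Then: 1. $D_3$ is a central division $F$-algebra of dimension $9$, and $K$ is a maximal (i.e. self-centralizing) subfield of $D_3$. 2. $(D_3,*)$ is formally real. 3. There is an isomorphism of $F$-algebras $D_3\otimes_F K\cong M_3(K)$ which sends $1\otimes k$ to the scalar matrix $kI$ for every $k\in K$. 4. The extension of $*$ to $D_3\otimes_F K$, given by $(d\otimes k)^*=d^*\otimes k^*$, is not formally real. Consequently, for a finite-dimensional central division algebra $D$ with involution over a field $F$ of characteristic $0$ and a $*$-invariant maximal subfield $K$ of $D$ that is Galois over $F$, formal reality of $D$ does not in general imply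 formal reality of the extended involution on $D\otimes_F K$. -/

import Mathlib

open scoped TensorProduct

noncomputable section

/-- The involution `star` of the ring `R` is formally real: every (nonempty) finite sum of nonzero
elements of the form `r * star r` is nonzero. -/
def IsFormallyRealInvolution (R : Type*) [Ring R] [StarRing R] : Prop :=
  ∀ (n : ℕ) (r : Fin n → R), 0 < n → (∀ i, r i * star (r i) ≠ 0) → ∑ i, r i * star (r i) ≠ 0

/-! ### Symbol algebras -/

namespace SymbolAlgebra

/-- The relations `x ^ n = a`, `y ^ n = b`, `y * x = ω * x * y` on the free algebra on
`x = ι 0` and `y = ι 1`. -/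
inductive Rel {F : Type*} [Field F] (n : ℕ) (ω a b : F) :
    FreeAlgebra F (Fin 2) → FreeAlgebra F (Fin 2) → Prop
  | x_pow : Rel n ω a b (FreeAlgebra.ι F 0 ^ n) (algebraMap F _ a)
  | y_pow : Rel n ω a b (FreeAlgebra.ι F 1 ^ n) (algebraMap F _ b)
  | y_mul_x : Rel n ω a b (FreeAlgebra.ι F 1 * FreeAlgebra.ι F 0)
      (algebraMap F _ ω * (FreeAlgebra.ι F 0 * FreeAlgebra.ι F 1))

end SymbolAlgebra

/-- The symbol algebra `A_ω(a, b; F)` of degree `n`: the `F`-algebra presented by two generators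
`x`, `y` and the relations `x ^ n = a`, `y ^ n = b`, `y * x = ω * x * y`. -/
abbrev SymbolAlgebra {F : Type*} [Field F] (n : ℕ) (ω a b : F) : Type _ :=
  RingQuot (SymbolAlgebra.Rel n ω a b)

namespace SymbolAlgebra

variable {F : Type*} [Field F] (n : ℕ) (ω a b : F)

/-- The first generator. -/
def x : SymbolAlgebra n ω a b :=
  RingQuot.mkAlgHom F (Rel n ω a b) (FreeAlgebra.ι F 0)

/-- The second generator. -/
def y : SymbolAlgebra n ω a b :=
  RingQuot.mkAlgHom F (Rel n ω a b) (FreeAlgebra.ι F 1)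

theorem x_pow : x n ω a b ^ n = algebraMap F _ a := by
  simpa [x] using RingQuot.mkAlgHom_rel F (Rel.x_pow (n := n) (ω := ω) (a := a) (b := b))

theorem y_pow : y n ω a b ^ n = algebraMap F _ b := by
  simpa [y] using RingQuot.mkAlgHom_rel F (Rel.y_pow (n := n) (ω := ω) (a := a) (b := b))

theorem y_mul_x : y n ω a b * x n ω a b = algebraMap F _ ω * (x n ω a b * y n ω a b) := by
  simpa [x, y] using RingQuot.mkAlgHom_rel F (Rel.y_mul_x (n := n) (ω := ω) (a := a) (b := b))

/-- An additive property of elements of a symbol algebra which holds for scalars and for the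
generators and is stable under products holds everywhere. -/
theorem induction {P : SymbolAlgebra n ω a b → Prop}
    (scalar : ∀ c : F, P (algebraMap F _ c)) (hx : P (x n ω a b)) (hy : P (y n ω a b))
    (mul : ∀ d e, P d → P e → P (d * e)) (add : ∀ d e, P d → P e → P (d + e))
    (d : SymbolAlgebra n ω a b) : P d := by
  obtain ⟨d, rfl⟩ := RingQuot.mkAlgHom_surjective F (Rel n ω a b) d
  induction d using FreeAlgebra.induction with
  | grade0 c => simpa using scalar c
  | grade1 i => fin_cases i; exacts [hx, hy]
  | mul d e hd he => simpa using mul _ _ hd he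
  | add d e hd he => simpa using add _ _ hd he

/-- The ring homomorphism from the free algebra to an arbitrary ring which is `φ` on scalars and `g`
on generators. -/
def freeLift {A : Type*} [Ring A] (φ : F →+* A) (hφ : ∀ c d, φ c * d = d * φ c) (g : Fin 2 → A) :
    FreeAlgebra F (Fin 2) →+* A :=
  letI := φ.toAlgebra' hφ
  (FreeAlgebra.lift F g).toRingHom

theorem freeLift_ι {A : Type*} [Ring A] (φ : F →+* A) (hφ : ∀ c d, φ c * d = d * φ c)
    (g : Fin 2 → A) (i : Fin 2) : freeLift φ hφ g (FreeAlgebra.ι F i) = g i :=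
  letI := φ.toAlgebra' hφ
  FreeAlgebra.lift_ι_apply g i

theorem freeLift_algebraMap {A : Type*} [Ring A] (φ : F →+* A) (hφ : ∀ c d, φ c * d = d * φ c)
    (g : Fin 2 → A) (c : F) : freeLift φ hφ g (algebraMap F _ c) = φ c :=
  letI := φ.toAlgebra' hφ
  (FreeAlgebra.lift F g).commutes c

section Involution

variable [StarRing F] {a b ω}

/-- The ring homomorphism from the free algebra to the opposite of the symbol algebra which
sends the generators to the generators and is the involution of `F` on scalars. -/
def freeStarHom : FreeAlgebra F (Fin 2) →+* (SymbolAlgebra n ω a b)ᵐᵒᵖ :=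
  freeLift ((algebraMap F (SymbolAlgebra n ω a b)ᵐᵒᵖ).comp (starRingEnd F))
    (fun c d => Algebra.commutes (star c) d)
    ![MulOpposite.op (x n ω a b), MulOpposite.op (y n ω a b)]

theorem freeStarHom_ι_zero : freeStarHom n (FreeAlgebra.ι F 0) = MulOpposite.op (x n ω a b) :=
  freeLift_ι _ _ _ 0

theorem freeStarHom_ι_one : freeStarHom n (FreeAlgebra.ι F 1) = MulOpposite.op (y n ω a b) :=
  freeLift_ι _ _ _ 1

theorem freeStarHom_algebraMap (c : F) :
    freeStarHom n (algebraMap F _ c) =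
      MulOpposite.op (algebraMap F (SymbolAlgebra n ω a b) (star c)) :=
  freeLift_algebraMap _ _ _ c

theorem freeStarHom_rel (ha : star a = a) (hb : star b = b) (hω : star ω * ω = 1)
    ⦃u v : FreeAlgebra F (Fin 2)⦄ (h : Rel n ω a b u v) :
    freeStarHom n (ω := ω) (a := a) (b := b) u = freeStarHom n v := by
  cases h with
  | x_pow => rw [map_pow, freeStarHom_ι_zero, freeStarHom_algebraMap, ha, ← MulOpposite.op_pow,
      x_pow]
  | y_pow => rw [map_pow, freeStarHom_ι_one, freeStarHom_algebraMap, hb, ← MulOpposite.op_pow,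
      y_pow]
  | y_mul_x =>
    rw [map_mul, map_mul, map_mul, freeStarHom_ι_one, freeStarHom_ι_zero, freeStarHom_algebraMap,
      ← MulOpposite.op_mul, ← MulOpposite.op_mul, ← MulOpposite.op_mul, y_mul_x,
      mul_assoc, ← Algebra.commutes, ← mul_assoc, ← Algebra.commutes, ← mul_assoc, ← map_mul, hω,
      map_one, one_mul]

/-- The anti-homomorphism underlying the involution. -/
def starHom (ha : star a = a) (hb : star b = b) (hω : star ω * ω = 1) :
    SymbolAlgebra n ω a b →+* (SymbolAlgebra n ω a b)ᵐᵒᵖ :=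
  RingQuot.lift ⟨freeStarHom n, freeStarHom_rel n ha hb hω⟩

variable (ha : star a = a) (hb : star b = b) (hω : star ω * ω = 1)

theorem starHom_x : starHom n ha hb hω (x n ω a b) = MulOpposite.op (x n ω a b) := by
  rw [← freeStarHom_ι_zero, starHom, x, ← RingHom.coe_coe (RingQuot.mkAlgHom F _),
    RingQuot.mkAlgHom_coe, RingQuot.lift_mkRingHom_apply]

theorem starHom_y : starHom n ha hb hω (y n ω a b) = MulOpposite.op (y n ω a b) := by
  rw [← freeStarHom_ι_one, starHom, y, ← RingHom.coe_coe (RingQuot.mkAlgHom F _),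
    RingQuot.mkAlgHom_coe, RingQuot.lift_mkRingHom_apply]

theorem starHom_algebraMap (c : F) : starHom n ha hb hω (algebraMap F _ c) =
    MulOpposite.op (algebraMap F _ (star c)) := by
  rw [← freeStarHom_algebraMap, ← (RingQuot.mkAlgHom F (Rel n ω a b)).commutes c, starHom,
    ← RingHom.coe_coe (RingQuot.mkAlgHom F _), RingQuot.mkAlgHom_coe,
    RingQuot.lift_mkRingHom_apply]

/-- The involution of the symbol algebra `A_ω(a, b; F)` which fixes `x` and `y` and extends a given
involution of `F` such that `star a = a`, `star b = b`, `star ω = ω⁻¹`. -/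
@[reducible] def starRing : StarRing (SymbolAlgebra n ω a b) where
  star d := (starHom n ha hb hω d).unop
  star_involutive d := by
    change (starHom n ha hb hω (starHom n ha hb hω d).unop).unop = d
    induction d using SymbolAlgebra.induction with
    | scalar c => simp [starHom_algebraMap]
    | hx => simp [starHom_x]
    | hy => simp [starHom_y]
    | mul d e hd he => simp [hd, he]
    | add d e hd he => simp [hd, he]
  star_mul d e := by simp
  star_add d e := by simp

end Involution

end SymbolAlgebra

/-! ### The field `ℂ(a, b)` -/

/-- The field `F = ℂ(a, b)` of complex rational functions in two variables. -/
abbrev RatFun : Type := FractionRing (MvPolynomial (Fin 2) ℂ)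

namespace RatFun

/-- The first variable. -/
def a : RatFun := algebraMap (MvPolynomial (Fin 2) ℂ) RatFun (MvPolynomial.X 0)

/-- The second variable. -/
def b : RatFun := algebraMap (MvPolynomial (Fin 2) ℂ) RatFun (MvPolynomial.X 1)

/-- The primitive third root of unity `(-1 + i √3) / 2`. -/
def rootOfUnity : ℂ := (-1 + Complex.I * (Real.sqrt 3 : ℂ)) / 2

/-- The constant function `ε = (-1 + i √3) / 2`. -/
def ε : RatFun := algebraMap (MvPolynomial (Fin 2) ℂ) RatFun (MvPolynomial.C rootOfUnity)

/-- Conjugation of the coefficients of polynomials. -/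
def polyConj : MvPolynomial (Fin 2) ℂ →+* MvPolynomial (Fin 2) ℂ :=
  MvPolynomial.map (starRingEnd ℂ)

theorem polyConj_polyConj (p : MvPolynomial (Fin 2) ℂ) : polyConj (polyConj p) = p := by
  rw [polyConj, MvPolynomial.map_map]
  have : (starRingEnd ℂ).comp (starRingEnd ℂ) = RingHom.id ℂ := by ext z; simp
  rw [this, MvPolynomial.map_id]

theorem polyConj_injective : Function.Injective polyConj :=
  Function.LeftInverse.injective polyConj_polyConj

/-- Conjugation of the coefficients of rational functions. -/
def conj : RatFun →+* RatFun :=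
  IsFractionRing.map (A := MvPolynomial (Fin 2) ℂ) (B := MvPolynomial (Fin 2) ℂ)
    (K := RatFun) (L := RatFun) polyConj_injective

theorem conj_algebraMap (p : MvPolynomial (Fin 2) ℂ) :
    conj (algebraMap _ RatFun p) = algebraMap _ RatFun (polyConj p) :=
  IsLocalization.map_eq (M := nonZeroDivisors (MvPolynomial (Fin 2) ℂ))
    (S := RatFun) (T := nonZeroDivisors (MvPolynomial (Fin 2) ℂ)) (Q := RatFun)
    (nonZeroDivisors_le_comap_nonZeroDivisors_of_injective _ polyConj_injective) p

/-- The involution of `ℂ(a, b)` which fixes `a` and `b` and conjugates `ℂ`. -/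
instance : StarRing RatFun where
  star := conj
  star_involutive r := by
    obtain ⟨p, q, -, rfl⟩ := IsFractionRing.div_surjective (A := MvPolynomial (Fin 2) ℂ) r
    simp only [map_div₀, conj_algebraMap, polyConj_polyConj]
  star_mul r s := by rw [map_mul, mul_comm]
  star_add := map_add conj

theorem star_algebraMap (p : MvPolynomial (Fin 2) ℂ) :
    star (algebraMap _ RatFun p) = algebraMap _ RatFun (polyConj p) :=
  conj_algebraMap p

theorem star_a : star a = a := by simp [a, star_algebraMap, polyConj]

theorem star_b : star b = b := by simp [b, star_algebraMap, polyConj]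

theorem star_const (z : ℂ) :
    star (algebraMap (MvPolynomial (Fin 2) ℂ) RatFun (MvPolynomial.C z)) =
      algebraMap (MvPolynomial (Fin 2) ℂ) RatFun (MvPolynomial.C (starRingEnd ℂ z)) := by
  simp [star_algebraMap, polyConj]

theorem star_ε_mul_ε : star ε * ε = 1 := by
  have h3 : ((Real.sqrt 3 : ℝ) : ℂ) ^ 2 = 3 := by
    rw [← Complex.ofReal_pow, Real.sq_sqrt (by norm_num)]; norm_num
  have h : starRingEnd ℂ rootOfUnity * rootOfUnity = 1 := by
    simp only [rootOfUnity, map_div₀, map_add, map_neg, map_one, map_mul, Complex.conj_I,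
      Complex.conj_ofReal, map_ofNat]
    linear_combination (-Complex.I ^ 2 / 4) * h3 - (3 / 4 : ℂ) * Complex.I_sq
  rw [ε, star_const, ← map_mul, ← map_mul, h, map_one, map_one]

end RatFun

/-! ### The algebra `D₃` and its subfield `K = F(x)` -/

/-- The symbol algebra `D₃ = A_ε(a, b; F)` of degree three over `F = ℂ(a, b)`. -/
abbrev D₃ : Type := SymbolAlgebra 3 RatFun.ε RatFun.a RatFun.b

namespace D₃

/-- The generator `x`, with `x ^ 3 = a`. -/
def x : D₃ := SymbolAlgebra.x 3 RatFun.ε RatFun.a RatFun.b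

/-- The generator `y`, with `y ^ 3 = b`. -/
def y : D₃ := SymbolAlgebra.y 3 RatFun.ε RatFun.a RatFun.b

/-- The involution of `D₃` which fixes `a`, `b`, `x`, `y` and conjugates `ℂ`. -/
instance : StarRing D₃ :=
  SymbolAlgebra.starRing 3 RatFun.star_a RatFun.star_b RatFun.star_ε_mul_ε

theorem star_x : star x = x :=
  congrArg MulOpposite.unop
    (SymbolAlgebra.starHom_x 3 RatFun.star_a RatFun.star_b RatFun.star_ε_mul_ε)

theorem star_y : star y = y :=
  congrArg MulOpposite.unop
    (SymbolAlgebra.starHom_y 3 RatFun.star_a RatFun.star_b RatFun.star_ε_mul_ε)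

theorem star_algebraMap (c : RatFun) :
    star (algebraMap RatFun D₃ c) = algebraMap RatFun D₃ (star c) :=
  congrArg MulOpposite.unop
    (SymbolAlgebra.starHom_algebraMap 3 RatFun.star_a RatFun.star_b RatFun.star_ε_mul_ε c)

instance : StarModule RatFun D₃ where
  star_smul c d := by
    rw [Algebra.smul_def, Algebra.smul_def, star_mul, star_algebraMap, Algebra.commutes]

/-- The star-invariant subalgebra `K = F(x) = F[x]` of `D₃`. -/
def K : StarSubalgebra RatFun D₃ where
  toSubalgebra := Algebra.adjoin RatFun {x}
  star_mem' {d} hd := by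
    change star d ∈ Algebra.adjoin RatFun {x}
    change d ∈ Algebra.adjoin RatFun {x} at hd
    induction hd using Algebra.adjoin_induction with
    | mem d hd =>
      rw [Set.mem_singleton_iff.1 hd, star_x]
      exact Algebra.self_mem_adjoin_singleton _ _
    | algebraMap c => rw [star_algebraMap]; exact Subalgebra.algebraMap_mem _ _
    | add d e _ _ hd he => rw [star_add]; exact add_mem hd he
    | mul d e _ _ hd he => rw [star_mul]; exact mul_mem he hd

end D₃

end

/-! Every element of `D₃` is, up to a nonzero factor from `ℂ[a, b]`, a polynomial in `x` and `y`
with complex coefficients, so questions about zero divisors and sums `∑ r r*` reduce to the quantum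
plane `y x = ω x y`. The presentation does not collapse: `x` and `y` act on `ℂ(s, t)`, with `a = s³`
and `b = t³`, and applying an operator to `1` recovers its normally ordered polynomial
(`normalOrder_injective`). In the quantum plane leading terms for the lexicographic order multiply
up to a power of `ω`, which gives a domain. If `m` is the largest exponent in a finite family `p_j`,
the coefficient of `∑ p_j p_j*` at `2m` is `∑ |c_j|²` times one common power of `ω`; this is nonzero
and gives formal reality (`sum_twistedMul_twistedStar_ne_zero`). Averaging over conjugation by
powers of `x` and of `y` yields the centralizer of `K` and the center. Formal reality fails over `K`
because `X = x ⊗ 1` and `Z = 1 ⊗ x` are commuting self-adjoint elements with equal cubes, yet `X ≠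
Z`. Where `u = X / Z` differs from `1` it satisfies `u² + u + 1 = 0`, so the self-adjoint element `u
(u - 1)` squares to `-3`. That the resulting terms are nonzero is read off from an explicit
representation of `D₃ ⊗ K` by `3 × 3` matrices over `K`; its surjectivity also gives dimension `9`
and the splitting. -/

noncomputable section

/-! ### Universal property and commutation rules of symbol algebras. -/

namespace SymbolAlgebra

variable {F : Type*} [Field F] {n : ℕ} {ω a b : F}

/-- The universal property of the symbol algebra. -/
def lift {A : Type*} [Ring A] [Algebra F A] {X Y : A} (hX : X ^ n = algebraMap F A a)
    (hY : Y ^ n = algebraMap F A b) (hYX : Y * X = algebraMap F A ω * (X * Y)) :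
    SymbolAlgebra n ω a b →ₐ[F] A :=
  RingQuot.liftAlgHom F ⟨FreeAlgebra.lift F ![X, Y], by
    intro u v h
    cases h <;> simp [hX, hY, hYX]⟩

section lift

variable {A : Type*} [Ring A] [Algebra F A] {X Y : A} (hX : X ^ n = algebraMap F A a)
    (hY : Y ^ n = algebraMap F A b) (hYX : Y * X = algebraMap F A ω * (X * Y))

@[simp]
theorem lift_x : lift hX hY hYX (x n ω a b) = X := by
  simp [lift, x, RingQuot.liftAlgHom_mkAlgHom_apply]

@[simp]
theorem lift_y : lift hX hY hYX (y n ω a b) = Y := by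
  simp [lift, y, RingQuot.liftAlgHom_mkAlgHom_apply]

end lift

variable (n ω a b)

theorem y_mul_x_pow (i : ℕ) :
    y n ω a b * x n ω a b ^ i = ω ^ i • (x n ω a b ^ i * y n ω a b) := by
  induction i with
  | zero => simp
  | succ i ih =>
    rw [pow_succ, ← mul_assoc, ih, smul_mul_assoc, mul_assoc, y_mul_x, ← Algebra.smul_def,
      mul_smul_comm, smul_smul, ← pow_succ, mul_assoc]

theorem y_pow_mul_x_pow (j i : ℕ) :
    y n ω a b ^ j * x n ω a b ^ i = ω ^ (j * i) • (x n ω a b ^ i * y n ω a b ^ j) := by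
  induction j with
  | zero => simp
  | succ j ih =>
    rw [pow_succ', mul_assoc, ih, mul_smul_comm, ← mul_assoc, y_mul_x_pow, smul_mul_assoc,
      smul_smul, mul_assoc, ← pow_add, ← pow_succ', Nat.succ_mul]

theorem monomial_mul_monomial (i j k l : ℕ) :
    x n ω a b ^ i * y n ω a b ^ j * (x n ω a b ^ k * y n ω a b ^ l) =
      ω ^ (j * k) • (x n ω a b ^ (i + k) * y n ω a b ^ (j + l)) := by
  rw [mul_assoc, ← mul_assoc (y n ω a b ^ j), y_pow_mul_x_pow, smul_mul_assoc, mul_smul_comm,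
    mul_assoc, ← pow_add, ← mul_assoc, ← pow_add]

end SymbolAlgebra

/-! ### The root of unity `ε`, and `ℂ(s, t)` as an extension of `ℂ(a, b)`. -/

namespace RatFun

theorem rootOfUnity_sq : rootOfUnity ^ 2 + rootOfUnity + 1 = 0 := by
  have h3 : ((Real.sqrt 3 : ℝ) : ℂ) ^ 2 = 3 := by
    rw [← Complex.ofReal_pow, Real.sq_sqrt (by norm_num)]; norm_num
  simp only [rootOfUnity]
  linear_combination (Complex.I ^ 2 / 4) * h3 + (3 / 4 : ℂ) * Complex.I_sq

theorem rootOfUnity_pow_three : rootOfUnity ^ 3 = 1 := by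
  linear_combination (rootOfUnity - 1) * rootOfUnity_sq

theorem rootOfUnity_ne_zero : rootOfUnity ≠ 0 := fun h => by
  simpa [h] using rootOfUnity_sq

theorem algebraMap_rootOfUnity : algebraMap ℂ RatFun rootOfUnity = ε :=
  IsScalarTower.algebraMap_apply ℂ (MvPolynomial (Fin 2) ℂ) RatFun rootOfUnity

theorem ε_sq : ε ^ 2 + ε + 1 = 0 := by
  rw [← algebraMap_rootOfUnity, ← map_pow, ← map_add, ← map_one (algebraMap ℂ RatFun), ← map_add,
    rootOfUnity_sq, map_zero]

theorem ε_pow_three : ε ^ 3 = 1 := by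
  linear_combination (ε - 1) * ε_sq

theorem ε_ne_one : ε ≠ 1 := fun h => by
  have := ε_sq
  rw [h] at this
  norm_num at this

theorem a_ne_zero : a ≠ 0 := by simp [a]

theorem b_ne_zero : b ≠ 0 := by simp [b]

theorem star_algebraMap_complex (z : ℂ) :
    star (algebraMap ℂ RatFun z) = algebraMap ℂ RatFun (starRingEnd ℂ z) := by
  rw [IsScalarTower.algebraMap_apply ℂ (MvPolynomial (Fin 2) ℂ) RatFun,
    IsScalarTower.algebraMap_apply ℂ (MvPolynomial (Fin 2) ℂ) RatFun]
  exact star_const z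

/-- The endomorphism `a ↦ a ^ 3`, `b ↦ b ^ 3` of `ℂ(a, b)`. -/
def cube : RatFun →+* RatFun :=
  IsFractionRing.lift (A := MvPolynomial (Fin 2) ℂ) (K := RatFun) (L := RatFun)
    (g := (algebraMap (MvPolynomial (Fin 2) ℂ) RatFun).comp
      (MvPolynomial.expand 3 : MvPolynomial (Fin 2) ℂ →ₐ[ℂ] _).toRingHom)
    ((IsFractionRing.injective _ _).comp (MvPolynomial.expand_injective (by norm_num)))

/-- The field `ℂ(s, t)`, viewed as an extension of `ℂ(a, b)` through `a = s ^ 3`, `b = t ^ 3`. -/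
def CubeRootField : Type := RatFun

instance : Field CubeRootField := inferInstanceAs (Field RatFun)

instance : Algebra RatFun CubeRootField := cube.toAlgebra

end RatFun

namespace RatFun

open MvPolynomial in
/-- The automorphism `s ↦ ε s`, `t ↦ t` of `ℂ[s, t]`. -/
def polyRotate : MvPolynomial (Fin 2) ℂ →ₐ[ℂ] MvPolynomial (Fin 2) ℂ :=
  aeval ![C rootOfUnity * X 0, X 1]

theorem polyRotate_X_zero :
    polyRotate (MvPolynomial.X 0) = MvPolynomial.C rootOfUnity * MvPolynomial.X 0 := by
  simp [polyRotate]

theorem polyRotate_X_one : polyRotate (MvPolynomial.X 1) = MvPolynomial.X 1 := by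
  simp [polyRotate]

theorem polyRotate_polyRotate_polyRotate (p : MvPolynomial (Fin 2) ℂ) :
    polyRotate (polyRotate (polyRotate p)) = p := by
  suffices h : polyRotate.comp (polyRotate.comp polyRotate) = AlgHom.id ℂ _ from
    DFunLike.congr_fun h p
  ext i
  fin_cases i
  · simp only [Fin.zero_eta, AlgHom.comp_apply, polyRotate_X_zero, map_mul, MvPolynomial.algHom_C,
      MvPolynomial.algebraMap_eq, AlgHom.id_apply, ← mul_assoc]
    rw [← MvPolynomial.C_mul, ← MvPolynomial.C_mul, ← pow_two, ← pow_succ, rootOfUnity_pow_three,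
      MvPolynomial.C_1, one_mul]
  · simp [polyRotate_X_one]

theorem polyRotate_injective : Function.Injective polyRotate := fun p q h => by
  rw [← polyRotate_polyRotate_polyRotate p, h, polyRotate_polyRotate_polyRotate]

theorem cube_algebraMap (p : MvPolynomial (Fin 2) ℂ) :
    cube (algebraMap _ RatFun p) = algebraMap _ RatFun (MvPolynomial.expand 3 p) :=
  IsFractionRing.lift_algebraMap _ p

namespace CubeRootField

/-- The inclusion of `ℂ[s, t]` in `ℂ(s, t)`. -/
def ofPoly : MvPolynomial (Fin 2) ℂ →+* CubeRootField :=
  algebraMap (MvPolynomial (Fin 2) ℂ) RatFun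

theorem ofPoly_injective : Function.Injective ofPoly :=
  IsFractionRing.injective (MvPolynomial (Fin 2) ℂ) RatFun

theorem algebraMap_algebraMap (p : MvPolynomial (Fin 2) ℂ) :
    algebraMap RatFun CubeRootField (algebraMap _ RatFun p) = ofPoly (MvPolynomial.expand 3 p) :=
  cube_algebraMap p

theorem algebraMap_a : algebraMap RatFun CubeRootField a = ofPoly (MvPolynomial.X 0) ^ 3 := by
  rw [a, algebraMap_algebraMap, MvPolynomial.expand_X, map_pow]

theorem algebraMap_b : algebraMap RatFun CubeRootField b = ofPoly (MvPolynomial.X 1) ^ 3 := by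
  rw [b, algebraMap_algebraMap, MvPolynomial.expand_X, map_pow]

theorem algebraMap_complex (z : ℂ) :
    algebraMap RatFun CubeRootField (algebraMap ℂ RatFun z) = ofPoly (MvPolynomial.C z) := by
  rw [IsScalarTower.algebraMap_apply ℂ (MvPolynomial (Fin 2) ℂ) RatFun, algebraMap_algebraMap,
    MvPolynomial.algebraMap_eq, MvPolynomial.expand_C]

/-- The ring endomorphism `s ↦ ε s`, `t ↦ t` of `ℂ(s, t)`. -/
def rotateHom : CubeRootField →+* CubeRootField :=
  IsFractionRing.map (A := MvPolynomial (Fin 2) ℂ) (B := MvPolynomial (Fin 2) ℂ)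
    (K := RatFun) (L := RatFun) (j := polyRotate.toRingHom) polyRotate_injective

theorem rotateHom_ofPoly (p : MvPolynomial (Fin 2) ℂ) :
    rotateHom (ofPoly p) = ofPoly (polyRotate p) :=
  IsLocalization.map_eq (M := nonZeroDivisors (MvPolynomial (Fin 2) ℂ))
    (S := RatFun) (T := nonZeroDivisors (MvPolynomial (Fin 2) ℂ)) (Q := RatFun)
    (g := polyRotate.toRingHom)
    (nonZeroDivisors_le_comap_nonZeroDivisors_of_injective _ polyRotate_injective) p

/-- Only `s³` and `t³` occur, and `ε³ = 1`. This is what makes the rotation linear over `ℂ(a, b)`.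
-/
theorem polyRotate_expand (p : MvPolynomial (Fin 2) ℂ) :
    polyRotate (MvPolynomial.expand 3 p) = MvPolynomial.expand 3 p := by
  suffices h : polyRotate.comp (MvPolynomial.expand 3) = MvPolynomial.expand 3 from
    DFunLike.congr_fun h p
  ext i
  fin_cases i
  · simp only [Fin.zero_eta, AlgHom.comp_apply, MvPolynomial.expand_X, map_pow, polyRotate_X_zero,
      mul_pow]
    rw [← MvPolynomial.C_pow, rootOfUnity_pow_three, MvPolynomial.C_1, one_mul]
  · simp [polyRotate_X_one]

/-- The automorphism `s ↦ ε s`, `t ↦ t` of `ℂ(s, t)` over `ℂ(a, b)`. -/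
def rotate : CubeRootField →ₐ[RatFun] CubeRootField where
  toRingHom := rotateHom
  commutes' c := by
    suffices h : rotateHom.comp (algebraMap RatFun CubeRootField) =
      algebraMap RatFun CubeRootField from DFunLike.congr_fun h c
    refine IsLocalization.ringHom_ext (nonZeroDivisors (MvPolynomial (Fin 2) ℂ)) ?_
    refine RingHom.ext fun p => ?_
    simp only [RingHom.comp_apply, algebraMap_algebraMap, rotateHom_ofPoly, polyRotate_expand]

theorem rotate_ofPoly (p : MvPolynomial (Fin 2) ℂ) : rotate (ofPoly p) = ofPoly (polyRotate p) :=
  rotateHom_ofPoly p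

/-- The action of `y` on `ℂ(s, t)`. -/
def mulRotate : Module.End RatFun CubeRootField :=
  LinearMap.mulLeft RatFun (ofPoly (MvPolynomial.X 1)) ∘ₗ rotate.toLinearMap

theorem mulRotate_apply (f : CubeRootField) :
    mulRotate f = ofPoly (MvPolynomial.X 1) * rotate f := rfl

theorem rotate_rotate_rotate (f : CubeRootField) : rotate (rotate (rotate f)) = f := by
  obtain ⟨p, q, -, h⟩ := IsFractionRing.div_surjective (A := MvPolynomial (Fin 2) ℂ) (K := RatFun) f
  have h' : f = ofPoly p / ofPoly q := h.symm
  rw [h']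
  simp only [map_div₀, rotate_ofPoly, polyRotate_polyRotate_polyRotate]

end CubeRootField

end RatFun

/-! ### The action of `D₃` on `ℂ(s, t)` and normal ordering. -/

namespace D₃

open RatFun RatFun.CubeRootField

/-- The action of `D₃` on `ℂ(s, t)`: `x` acts by multiplication with `s` and `y` acts by the
substitution `s ↦ ε s` followed by multiplication with `t`. -/
def action : D₃ →ₐ[RatFun] Module.End RatFun CubeRootField :=
  SymbolAlgebra.lift (X := LinearMap.mulLeft RatFun (ofPoly (MvPolynomial.X 0))) (Y := mulRotate)
    (by
      ext f
      simp only [pow_succ, pow_zero, one_mul, Module.End.mul_apply, LinearMap.mulLeft_apply,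
        Module.algebraMap_end_apply, Algebra.smul_def, algebraMap_a]
      ring)
    (by
      ext f
      simp only [pow_succ, pow_zero, one_mul, Module.End.mul_apply, mulRotate_apply, map_mul,
        rotate_ofPoly, polyRotate_X_one, rotate_rotate_rotate,
        Module.algebraMap_end_apply, Algebra.smul_def, algebraMap_b]
      ring)
    (by
      ext f
      simp only [Module.End.mul_apply, mulRotate_apply, map_mul, LinearMap.mulLeft_apply,
        rotate_ofPoly, polyRotate_X_zero,
        Module.algebraMap_end_apply, Algebra.smul_def, ← algebraMap_rootOfUnity, algebraMap_complex]
      ring)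

theorem action_x : action x = LinearMap.mulLeft RatFun (ofPoly (MvPolynomial.X 0)) :=
  SymbolAlgebra.lift_x _ _ _

theorem action_y : action y = mulRotate :=
  SymbolAlgebra.lift_y _ _ _

/-- In normal order the powers of `y` act first, on powers of `t`, which the rotation fixes; hence
no power of `ε` appears. -/
theorem action_monomial (i j : ℕ) : action (x ^ i * y ^ j) 1 =
    ofPoly (MvPolynomial.X 0) ^ i * ofPoly (MvPolynomial.X 1) ^ j := by
  have hy : ∀ j : ℕ, action (y ^ j) 1 = ofPoly (MvPolynomial.X 1) ^ j := by
    intro j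
    induction j with
    | zero => simp
    | succ j ih =>
      rw [pow_succ', map_mul, Module.End.mul_apply, ih, action_y, mulRotate_apply, map_pow,
        rotate_ofPoly, polyRotate_X_one, pow_succ']
  induction i with
  | zero => rw [pow_zero, pow_zero, one_mul, one_mul, hy]
  | succ i ih =>
    rw [pow_succ', mul_assoc, map_mul, Module.End.mul_apply, ih, action_x, LinearMap.mulLeft_apply,
      pow_succ', mul_assoc]

/-- Normal ordering: the linear map from `ℂ[s, t]` to `D₃` which sends `s ^ i * t ^ j` to
`x ^ i * y ^ j`. -/
def normalOrder : MvPolynomial (Fin 2) ℂ →ₗ[ℂ] D₃ :=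
  (MvPolynomial.basisMonomials (Fin 2) ℂ).constr ℂ fun m => x ^ m 0 * y ^ m 1

theorem normalOrder_monomial (m : Fin 2 →₀ ℕ) (c : ℂ) :
    normalOrder (MvPolynomial.monomial m c) = c • (x ^ m 0 * y ^ m 1) := by
  rw [← mul_one c, ← smul_eq_mul, ← MvPolynomial.smul_monomial, map_smul, smul_eq_mul, mul_one,
    normalOrder]
  exact congrArg (c • ·) ((MvPolynomial.basisMonomials (Fin 2) ℂ).constr_basis ℂ _ m)

theorem action_normalOrder (p : MvPolynomial (Fin 2) ℂ) : action (normalOrder p) 1 = ofPoly p := by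
  induction p using MvPolynomial.induction_on' with
  | monomial m c =>
    rw [normalOrder_monomial, ← algebraMap_smul RatFun c, map_smul, LinearMap.smul_apply,
      action_monomial, Algebra.smul_def, algebraMap_complex, MvPolynomial.monomial_eq,
      Finsupp.prod_fintype _ _ (by simp)]
    simp
  | add p q hp hq => rw [map_add, map_add, LinearMap.add_apply, hp, hq, map_add]

/-- The monomials `x ^ i * y ^ j`, for all `i` and `j`, are linearly independent over `ℂ`, though
not over `ℂ(a, b)`. Identities in `D₃` can therefore be refuted by comparing coefficients. -/
theorem normalOrder_injective : Function.Injective normalOrder := fun p q h =>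
  ofPoly_injective (by rw [← action_normalOrder, h, action_normalOrder])

end D₃

/-! ### Leading terms in the quantum plane. -/

namespace QuantumPlane

open MvPolynomial

/-- The product of the quantum plane `y * x = ω * x * y`, with elements written as polynomials whose
monomials are normally ordered. -/
def twistedMul (ω : ℂ) (p q : MvPolynomial (Fin 2) ℂ) : MvPolynomial (Fin 2) ℂ :=
  ∑ m ∈ p.support, ∑ n ∈ q.support,
    monomial (m + n) (p.coeff m * q.coeff n * ω ^ (m 1 * n 0))

/-- The involution of the quantum plane which fixes the generators and conjugates scalars. -/
def twistedStar (ω : ℂ) (p : MvPolynomial (Fin 2) ℂ) : MvPolynomial (Fin 2) ℂ :=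
  ∑ m ∈ p.support, monomial m (starRingEnd ℂ (p.coeff m) * ω ^ (m 0 * m 1))

theorem coeff_twistedStar (ω : ℂ) (p : MvPolynomial (Fin 2) ℂ) (m : Fin 2 →₀ ℕ) :
    (twistedStar ω p).coeff m = starRingEnd ℂ (p.coeff m) * ω ^ (m 0 * m 1) := by
  rw [twistedStar, coeff_sum]
  simp only [coeff_monomial]
  rw [Finset.sum_ite_eq' p.support m]
  split_ifs with h
  · rfl
  · rw [notMem_support_iff.1 h, map_zero, zero_mul]

/-- `m` bounds the exponents of `p` for the lexicographic order. -/
def IsLexBound (m : Fin 2 →₀ ℕ) (p : MvPolynomial (Fin 2) ℂ) : Prop :=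
  ∀ n, p.coeff n ≠ 0 → toLex n ≤ toLex m

/-- One exponent has to serve the whole family: it is the maximum of the union of the supports, so
some members may have coefficient zero there. -/
theorem exists_isLexBound {ι : Type*} [Fintype ι] (p : ι → MvPolynomial (Fin 2) ℂ) {i : ι}
    (hi : p i ≠ 0) : ∃ m, (∀ j, IsLexBound m (p j)) ∧ ∃ j, (p j).coeff m ≠ 0 := by
  classical
  obtain ⟨n, hn⟩ := support_nonempty.2 hi
  obtain ⟨m, hm, hmax⟩ := (Finset.univ.biUnion fun j => (p j).support).exists_max_image toLex
    ⟨n, Finset.mem_biUnion.2 ⟨i, Finset.mem_univ i, hn⟩⟩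
  obtain ⟨j, -, hj⟩ := Finset.mem_biUnion.1 hm
  exact ⟨m, fun k l hl => hmax l (Finset.mem_biUnion.2 ⟨k, Finset.mem_univ k, mem_support_iff.2 hl⟩),
    j, mem_support_iff.1 hj⟩

/-- The lexicographic order is compatible with addition, so exponents `k ≤ m` and `l ≤ n` with `k +
l = m + n` must be `m` and `n`; a single term contributes. -/
theorem coeff_twistedMul (ω : ℂ) {p q : MvPolynomial (Fin 2) ℂ} {m n : Fin 2 →₀ ℕ}
    (hm : IsLexBound m p) (hn : IsLexBound n q) :
    (twistedMul ω p q).coeff (m + n) = p.coeff m * q.coeff n * ω ^ (m 1 * n 0) := by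
  rw [twistedMul, coeff_sum]
  have key : ∀ k ∈ p.support, ∀ l ∈ q.support, k + l = m + n → k = m ∧ l = n := by
    intro k hk l hl h
    have hk' := hm k (mem_support_iff.1 hk)
    have hl' := hn l (mem_support_iff.1 hl)
    have h' : toLex k + toLex l = toLex m + toLex n := congrArg toLex h
    exact ⟨toLex.injective ((add_eq_add_iff_eq_and_eq hk' hl').1 h').1,
      toLex.injective ((add_eq_add_iff_eq_and_eq hk' hl').1 h').2⟩
  rw [Finset.sum_eq_single m]
  · rw [coeff_sum, Finset.sum_eq_single n]
    · rw [coeff_monomial, if_pos rfl]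
    · intro l _ hl
      rw [coeff_monomial, if_neg fun h => hl (add_left_cancel h)]
    · intro h
      rw [notMem_support_iff.1 h]
      simp
  · intro k hk hkm
    rw [coeff_sum]
    refine Finset.sum_eq_zero fun l hl => ?_
    rw [coeff_monomial, if_neg fun h => hkm (key k hk l hl h).1]
  · intro h
    rw [notMem_support_iff.1 h]
    simp

theorem twistedMul_ne_zero {ω : ℂ} (hω : ω ≠ 0) {p q : MvPolynomial (Fin 2) ℂ} (hp : p ≠ 0)
    (hq : q ≠ 0) : twistedMul ω p q ≠ 0 := by
  obtain ⟨m, hm, ⟨⟩, hmp⟩ := exists_isLexBound (fun _ : Unit => p) (i := ()) hp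
  obtain ⟨n, hn, ⟨⟩, hnq⟩ := exists_isLexBound (fun _ : Unit => q) (i := ()) hq
  intro h
  have := coeff_twistedMul ω (hm ()) (hn ())
  rw [h, coeff_zero] at this
  exact mul_ne_zero (mul_ne_zero hmp hnq) (pow_ne_zero _ hω) this.symm

/-- At the doubled maximal exponent each summand contributes `|c|²` times the same power of `ω`, so
the contributions cannot cancel. -/
theorem sum_twistedMul_twistedStar_ne_zero {ω : ℂ} (hω : ω ≠ 0) {ι : Type*} [Fintype ι]
    (p : ι → MvPolynomial (Fin 2) ℂ) {i : ι} (hi : p i ≠ 0) :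
    ∑ j, twistedMul ω (p j) (twistedStar ω (p j)) ≠ 0 := by
  obtain ⟨m, hm, j, hj⟩ := exists_isLexBound p hi
  have hm' : ∀ k, IsLexBound m (twistedStar ω (p k)) := fun k n hn =>
    hm k n fun h => hn (by rw [coeff_twistedStar, h, map_zero, zero_mul])
  intro h
  have h' := congrArg (coeff (m + m)) h
  rw [coeff_sum, coeff_zero] at h'
  have hterm : ∀ k, (twistedMul ω (p k) (twistedStar ω (p k))).coeff (m + m) =
      (Complex.normSq ((p k).coeff m) : ℂ) * ω ^ (m 0 * m 1 + m 1 * m 0) := by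
    intro k
    rw [coeff_twistedMul ω (hm k) (hm' k), coeff_twistedStar, ← Complex.mul_conj]
    ring
  simp only [hterm] at h'
  rw [← Finset.sum_mul] at h'
  have h0 := (mul_eq_zero.1 h').resolve_right (pow_ne_zero _ hω)
  rw [← Complex.ofReal_sum, Complex.ofReal_eq_zero,
    Finset.sum_eq_zero_iff_of_nonneg fun k _ => Complex.normSq_nonneg _] at h0
  exact hj (Complex.normSq_eq_zero.1 (h0 j (Finset.mem_univ j)))

end QuantumPlane

/-! ### Clearing denominators: `D₃` is a formally real domain. -/

namespace D₃

open RatFun QuantumPlane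

theorem star_complex_smul (c : ℂ) (d : D₃) : star (c • d) = starRingEnd ℂ c • star d := by
  rw [← algebraMap_smul RatFun c d, star_smul, star_algebraMap_complex, algebraMap_smul]

theorem ε_smul (k : ℕ) (d : D₃) : ε ^ k • d = rootOfUnity ^ k • d := by
  have h : ε ^ k = algebraMap ℂ RatFun (rootOfUnity ^ k) := by
    rw [map_pow, algebraMap_rootOfUnity]
  rw [h, algebraMap_smul]

theorem normalOrder_eq_sum (p : MvPolynomial (Fin 2) ℂ) :
    normalOrder p = ∑ m ∈ p.support, p.coeff m • (x ^ m 0 * y ^ m 1) := by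
  conv_lhs => rw [p.as_sum, map_sum]
  simp only [normalOrder_monomial]

theorem normalOrder_twistedMul (p q : MvPolynomial (Fin 2) ℂ) :
    normalOrder (twistedMul rootOfUnity p q) = normalOrder p * normalOrder q := by
  rw [normalOrder_eq_sum p, normalOrder_eq_sum q, Finset.sum_mul_sum, twistedMul, map_sum]
  refine Finset.sum_congr rfl fun m _ => ?_
  rw [map_sum]
  refine Finset.sum_congr rfl fun n _ => ?_
  rw [normalOrder_monomial, smul_mul_smul_comm, Finsupp.add_apply, Finsupp.add_apply, x, y,
    SymbolAlgebra.monomial_mul_monomial, ε_smul, smul_smul]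

theorem normalOrder_twistedStar (p : MvPolynomial (Fin 2) ℂ) :
    normalOrder (twistedStar rootOfUnity p) = star (normalOrder p) := by
  rw [normalOrder_eq_sum p, star_sum, twistedStar, map_sum]
  refine Finset.sum_congr rfl fun m _ => ?_
  rw [normalOrder_monomial, star_complex_smul, star_mul, star_pow, star_pow, star_x, star_y, x, y,
    SymbolAlgebra.y_pow_mul_x_pow, ε_smul, smul_smul, mul_comm (m 1)]

theorem x_eq_normalOrder : x = normalOrder (MvPolynomial.X 0) := by
  rw [MvPolynomial.X, normalOrder_monomial]; simp

theorem y_eq_normalOrder : y = normalOrder (MvPolynomial.X 1) := by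
  rw [MvPolynomial.X, normalOrder_monomial]; simp

theorem algebraMap_complex_eq_normalOrder (c : ℂ) :
    algebraMap RatFun D₃ (algebraMap ℂ RatFun c) = normalOrder (MvPolynomial.C c) := by
  rw [← MvPolynomial.monomial_zero', normalOrder_monomial, ← IsScalarTower.algebraMap_apply,
    Algebra.algebraMap_eq_smul_one]
  simp

theorem x_pow_three : x ^ 3 = algebraMap RatFun D₃ a := SymbolAlgebra.x_pow _ _ _ _

theorem y_pow_three : y ^ 3 = algebraMap RatFun D₃ b := SymbolAlgebra.y_pow _ _ _ _

theorem exists_normalOrder_mul (p q : MvPolynomial (Fin 2) ℂ) :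
    ∃ r, normalOrder r = normalOrder p * normalOrder q :=
  ⟨_, normalOrder_twistedMul p q⟩

/-- Since `a = x³` and `b = y³`, the scalars in `ℂ[a, b]` are themselves polynomials in `x` and `y`;
this permits passing to a common denominator. -/
theorem exists_normalOrder_eq_algebraMap (f : MvPolynomial (Fin 2) ℂ) :
    ∃ p, normalOrder p = algebraMap RatFun D₃ (algebraMap _ RatFun f) := by
  induction f using MvPolynomial.induction_on with
  | C c =>
    exact ⟨_, (algebraMap_complex_eq_normalOrder c).symm.trans <| congrArg _ <|
      IsScalarTower.algebraMap_apply ℂ (MvPolynomial (Fin 2) ℂ) RatFun c⟩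
  | add f g hf hg =>
    obtain ⟨p, hp⟩ := hf
    obtain ⟨q, hq⟩ := hg
    exact ⟨p + q, by rw [map_add, map_add, map_add, hp, hq]⟩
  | mul_X f i hf =>
    obtain ⟨p, hp⟩ := hf
    obtain ⟨q, hq⟩ : ∃ q, normalOrder q =
        algebraMap RatFun D₃ (algebraMap _ RatFun (MvPolynomial.X i)) := by
      fin_cases i
      · refine (exists_normalOrder_mul (MvPolynomial.X 0) (twistedMul rootOfUnity
          (MvPolynomial.X 0) (MvPolynomial.X 0))).imp fun r hr => hr.trans ?_
        rw [normalOrder_twistedMul, ← x_eq_normalOrder, ← pow_two, ← pow_succ', x_pow_three]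
        rfl
      · refine (exists_normalOrder_mul (MvPolynomial.X 1) (twistedMul rootOfUnity
          (MvPolynomial.X 1) (MvPolynomial.X 1))).imp fun r hr => hr.trans ?_
        rw [normalOrder_twistedMul, ← y_eq_normalOrder, ← pow_two, ← pow_succ', y_pow_three]
        rfl
    obtain ⟨r, hr⟩ := exists_normalOrder_mul p q
    exact ⟨r, by rw [hr, hp, hq, map_mul, map_mul]⟩

theorem exists_normalOrder_eq_smul_normalOrder (f p : MvPolynomial (Fin 2) ℂ) :
    ∃ q, normalOrder q = algebraMap _ RatFun f • normalOrder p := by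
  obtain ⟨g, hg⟩ := exists_normalOrder_eq_algebraMap f
  obtain ⟨q, hq⟩ := exists_normalOrder_mul g p
  exact ⟨q, by rw [hq, hg, Algebra.smul_def]⟩

/-- Every element of `D₃` becomes a polynomial in `x` and `y` after multiplication with a
suitable polynomial in `a` and `b`. -/
theorem exists_smul_eq_normalOrder (d : D₃) : ∃ f : MvPolynomial (Fin 2) ℂ, f ≠ 0 ∧
    ∃ p, normalOrder p = algebraMap _ RatFun f • d := by
  induction d using SymbolAlgebra.induction with
  | scalar c =>
    obtain ⟨p, q, hq, rfl⟩ := IsFractionRing.div_surjective (A := MvPolynomial (Fin 2) ℂ) c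
    have hq0 : q ≠ 0 := nonZeroDivisors.ne_zero hq
    refine ⟨q, hq0, ?_⟩
    obtain ⟨g, hg⟩ := exists_normalOrder_eq_algebraMap p
    refine ⟨g, ?_⟩
    rw [hg, Algebra.smul_def, ← map_mul, mul_div_cancel₀]
    simpa using hq0
  | hx => exact ⟨1, one_ne_zero, _, x_eq_normalOrder.symm.trans (by rw [map_one, one_smul]; rfl)⟩
  | hy => exact ⟨1, one_ne_zero, _, y_eq_normalOrder.symm.trans (by rw [map_one, one_smul]; rfl)⟩
  | mul d e hd he =>
    obtain ⟨f, hf, p, hp⟩ := hd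
    obtain ⟨g, hg, q, hq⟩ := he
    obtain ⟨r, hr⟩ := exists_normalOrder_mul p q
    exact ⟨f * g, mul_ne_zero hf hg, r, by rw [hr, hp, hq, map_mul, smul_mul_smul_comm]⟩
  | add d e hd he =>
    obtain ⟨f, hf, p, hp⟩ := hd
    obtain ⟨g, hg, q, hq⟩ := he
    obtain ⟨p', hp'⟩ := exists_normalOrder_eq_smul_normalOrder g p
    obtain ⟨q', hq'⟩ := exists_normalOrder_eq_smul_normalOrder f q
    refine ⟨f * g, mul_ne_zero hf hg, p' + q', ?_⟩
    rw [map_add, hp', hq', hp, hq, smul_smul, smul_smul, smul_add, map_mul, mul_comm]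

instance : NoZeroDivisors D₃ where
  eq_zero_or_eq_zero_of_mul_eq_zero {d e} h := by
    obtain ⟨f, hf, p, hp⟩ := exists_smul_eq_normalOrder d
    obtain ⟨g, hg, q, hq⟩ := exists_smul_eq_normalOrder e
    by_contra! hde
    have hne : ∀ {f p : MvPolynomial (Fin 2) ℂ} {d : D₃}, f ≠ 0 → normalOrder p = algebraMap _ RatFun f • d → d ≠ 0 →
        p ≠ 0 := by
      rintro f p d hf hp hd rfl
      rw [map_zero] at hp
      exact smul_ne_zero (by simpa using hf) hd hp.symm
    refine twistedMul_ne_zero rootOfUnity_ne_zero (hne hf hp hde.1) (hne hg hq hde.2)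
      (normalOrder_injective ?_)
    rw [normalOrder_twistedMul, hp, hq, smul_mul_smul_comm, h, smul_zero, map_zero]

instance : Nontrivial D₃ :=
  ⟨normalOrder 1, normalOrder 0, normalOrder_injective.ne one_ne_zero⟩

instance : IsDomain D₃ := NoZeroDivisors.to_isDomain _

/-- After multiplication by a common denominator `c`, all `r i` lie in the quantum plane. As `c` is
central, the sum is only multiplied by `c * star c`, whether or not `c` is self-adjoint. -/
theorem isFormallyRealInvolution : IsFormallyRealInvolution D₃ := by
  intro n r hn hr hsum
  choose f hf p hp using fun i => exists_smul_eq_normalOrder (r i)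
  have hq : ∀ i, ∃ q, normalOrder q = algebraMap _ RatFun (∏ j, f j) • r i := by
    intro i
    -- The denominator `f i` is already cleared in `p i`; the remaining factors bring it to the
    -- common one.
    obtain ⟨q, hq⟩ := exists_normalOrder_eq_smul_normalOrder (∏ j ∈ Finset.univ.erase i, f j) (p i)
    refine ⟨q, ?_⟩
    rw [hq, hp, smul_smul, ← map_mul, Finset.prod_erase_mul _ _ (Finset.mem_univ i)]
  choose q hq using hq
  have hc : algebraMap _ RatFun (∏ j, f j) ≠ 0 := by
    simpa [Finset.prod_eq_zero_iff] using hf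
  have h0 : q ⟨0, hn⟩ ≠ 0 := by
    intro h
    have := hq ⟨0, hn⟩
    rw [h, map_zero, eq_comm, smul_eq_zero_iff_right hc] at this
    exact hr ⟨0, hn⟩ (by rw [this, zero_mul])
  refine sum_twistedMul_twistedStar_ne_zero rootOfUnity_ne_zero q h0 (normalOrder_injective ?_)
  rw [map_sum, map_zero]
  simp only [normalOrder_twistedMul, normalOrder_twistedStar, hq, star_smul, smul_mul_smul_comm]
  rw [← Finset.smul_sum, hsum, smul_zero]

end D₃

/-! ### Dimension bound, the field `K`, its centralizer, and the center of `D₃`. -/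

namespace RatFun

theorem ε_pow_mod (k : ℕ) : ε ^ k = ε ^ (k % 3) := by
  conv_lhs => rw [← Nat.div_add_mod k 3, pow_add, pow_mul, ε_pow_three, one_pow, one_mul]

theorem one_add_ε_pow_eq_zero {k : ℕ} (hk : ¬ 3 ∣ k) : 1 + ε ^ k + ε ^ (2 * k) = 0 := by
  have : k % 3 = 1 ∨ k % 3 = 2 := by omega
  rw [mul_comm, pow_mul, ε_pow_mod k]
  rcases this with h | h <;> rw [h]
  · linear_combination ε_sq
  · linear_combination (ε ^ 2 - ε + 1) * ε_sq

theorem one_add_ε_pow_eq_three {k : ℕ} (hk : 3 ∣ k) : 1 + ε ^ k + ε ^ (2 * k) = 3 := by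
  rw [mul_comm, pow_mul, ε_pow_mod k, Nat.mod_eq_zero_of_dvd hk]
  norm_num

end RatFun

namespace D₃

open RatFun

theorem monomial_induction {P : D₃ → Prop} (zero : P 0) (monomial : ∀ i j, P (x ^ i * y ^ j))
    (add : ∀ d e, P d → P e → P (d + e)) (smul : ∀ (c : RatFun) d, P d → P (c • d)) (d : D₃) :
    P d := by
  obtain ⟨f, hf, p, hp⟩ := exists_smul_eq_normalOrder d
  have hf' : algebraMap _ RatFun f ≠ 0 := by simpa using hf
  rw [← inv_smul_smul₀ hf' d, ← hp, normalOrder_eq_sum]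
  refine smul _ _ (Finset.sum_induction _ P add zero fun m _ => ?_)
  rw [← algebraMap_smul RatFun]
  exact smul _ _ (monomial _ _)

theorem x_pow_eq (i : ℕ) : x ^ i = a ^ (i / 3) • x ^ (i % 3) := by
  conv_lhs => rw [← Nat.div_add_mod i 3, pow_add, pow_mul, x_pow_three, ← map_pow]
  rw [Algebra.smul_def]

theorem y_pow_eq (i : ℕ) : y ^ i = b ^ (i / 3) • y ^ (i % 3) := by
  conv_lhs => rw [← Nat.div_add_mod i 3, pow_add, pow_mul, y_pow_three, ← map_pow]
  rw [Algebra.smul_def]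

theorem span_monomials : Submodule.span RatFun
    (Set.range fun m : Fin 3 × Fin 3 => x ^ (m.1 : ℕ) * y ^ (m.2 : ℕ)) = ⊤ := by
  refine Submodule.eq_top_iff'.2 fun d => ?_
  induction d using monomial_induction with
  | zero => exact zero_mem _
  | add d e hd he => exact add_mem hd he
  | smul c d hd => exact Submodule.smul_mem _ c hd
  | monomial i j =>
    rw [x_pow_eq, y_pow_eq, smul_mul_smul_comm]
    exact Submodule.smul_mem _ _ <| Submodule.subset_span
      ⟨(⟨i % 3, Nat.mod_lt _ (by norm_num)⟩, ⟨j % 3, Nat.mod_lt _ (by norm_num)⟩), rfl⟩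

instance : FiniteDimensional RatFun D₃ :=
  Module.finite_def.2 (span_monomials ▸ Submodule.fg_span (Set.finite_range _))

theorem finrank_le : Module.finrank RatFun D₃ ≤ 9 := by
  simpa using finrank_le_of_span_eq_top span_monomials

/-- A finite-dimensional algebra without zero divisors is a division algebra. -/
theorem isUnit_of_ne_zero {d : D₃} (hd : d ≠ 0) : IsUnit d :=
  FiniteDimensional.isUnit RatFun hd

theorem x_mem_K : x ∈ K := Algebra.self_mem_adjoin_singleton _ _

theorem K_mul_comm (k l : K) : k * l = l * k :=
  (Algebra.isMulCommutative_adjoin RatFun (s := {x}) (by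
    rintro _ rfl _ rfl; rfl)).is_comm.comm k l

theorem isField_K : IsField K where
  exists_pair_ne := ⟨0, 1, zero_ne_one⟩
  mul_comm := K_mul_comm
  mul_inv_cancel {k} hk := by
    have : IsDomain K := inferInstanceAs (IsDomain (Algebra.adjoin RatFun {x}))
    have : FiniteDimensional RatFun K :=
      inferInstanceAs (FiniteDimensional RatFun (Algebra.adjoin RatFun {x}))
    exact (FiniteDimensional.isUnit RatFun hk).exists_right_inv

/-- The sum of the conjugates of `a • d` under powers of `x`. -/
def xTrace : D₃ →ₗ[RatFun] D₃ :=
  a • LinearMap.id + LinearMap.mulLeftRight RatFun (x, x ^ 2) +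
    LinearMap.mulLeftRight RatFun (x ^ 2, x)

theorem xTrace_apply (d : D₃) : xTrace d = a • d + x * d * x ^ 2 + x ^ 2 * d * x := rfl

/-- The sum of the conjugates of `b • d` under powers of `y`. -/
def yTrace : D₃ →ₗ[RatFun] D₃ :=
  b • LinearMap.id + LinearMap.mulLeftRight RatFun (y, y ^ 2) +
    LinearMap.mulLeftRight RatFun (y ^ 2, y)

theorem yTrace_apply (d : D₃) : yTrace d = b • d + y * d * y ^ 2 + y ^ 2 * d * y := rfl

theorem y_pow_mul_x_pow (j i : ℕ) : y ^ j * x ^ i = ε ^ (j * i) • (x ^ i * y ^ j) :=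
  SymbolAlgebra.y_pow_mul_x_pow _ _ _ _ j i

/-- Conjugation by `x` rescales a monomial by a power of `ε` depending on `j` alone. The eigenvalue
is `3a` if `3 ∣ j` and `0` otherwise, so up to the factor `3a` this is the projection to `K`. -/
theorem xTrace_monomial (i j : ℕ) :
    xTrace (x ^ i * y ^ j) = ((1 + ε ^ j + ε ^ (2 * j)) * a) • (x ^ i * y ^ j) := by
  have h : ∀ k l, k + l = 3 → x ^ k * (x ^ i * y ^ j) * x ^ l =
      (ε ^ (j * l) * a) • (x ^ i * y ^ j) := by
    intro k l hkl
    rw [mul_assoc, mul_assoc, y_pow_mul_x_pow, mul_smul_comm, mul_smul_comm, ← mul_assoc,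
      ← mul_assoc, ← pow_add, ← pow_add, mul_smul, Algebra.smul_def a, ← x_pow_three, ← mul_assoc,
      ← pow_add, show k + i + l = 3 + i by omega]
  have h1 := h 1 2 rfl
  have h2 := h 2 1 rfl
  rw [pow_one] at h1 h2
  rw [xTrace_apply, h1, h2, mul_comm j, mul_one, ← add_smul, ← add_smul]
  congr 1
  ring

theorem yTrace_monomial (i j : ℕ) :
    yTrace (x ^ i * y ^ j) = ((1 + ε ^ i + ε ^ (2 * i)) * b) • (x ^ i * y ^ j) := by
  have h : ∀ k l, k + l = 3 → y ^ k * (x ^ i * y ^ j) * y ^ l =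
      (ε ^ (k * i) * b) • (x ^ i * y ^ j) := by
    intro k l hkl
    rw [← mul_assoc, y_pow_mul_x_pow, smul_mul_assoc, smul_mul_assoc, mul_assoc, mul_assoc,
      ← pow_add, ← pow_add, mul_smul, Algebra.smul_def b, Algebra.commutes, ← y_pow_three,
      mul_assoc, ← pow_add, show k + (j + l) = j + 3 by omega]
  have h1 := h 1 2 rfl
  have h2 := h 2 1 rfl
  rw [pow_one] at h1 h2
  rw [yTrace_apply, h1, h2, one_mul, ← add_smul, ← add_smul]
  congr 1
  ring

theorem three_mul_ne_zero {c : RatFun} (hc : c ≠ 0) : 3 * c ≠ 0 :=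
  mul_ne_zero (by norm_num) hc

theorem xTrace_of_commute {d : D₃} (h : x * d = d * x) : xTrace d = (3 * a) • d := by
  have h1 : x * d * x ^ 2 = a • d := by
    rw [h, mul_assoc, ← pow_succ', x_pow_three, ← Algebra.commutes, Algebra.smul_def]
  have h2 : x ^ 2 * d * x = a • d := by
    rw [mul_assoc, ← h, ← mul_assoc, ← pow_succ, x_pow_three, Algebra.smul_def]
  rw [xTrace_apply, h1, h2, ← add_smul, ← add_smul]
  congr 1
  ring

theorem yTrace_of_commute {d : D₃} (h : y * d = d * y) : yTrace d = (3 * b) • d := by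
  have h1 : y * d * y ^ 2 = b • d := by
    rw [h, mul_assoc, ← pow_succ', y_pow_three, ← Algebra.commutes, Algebra.smul_def]
  have h2 : y ^ 2 * d * y = b • d := by
    rw [mul_assoc, ← h, ← mul_assoc, ← pow_succ, y_pow_three, Algebra.smul_def]
  rw [yTrace_apply, h1, h2, ← add_smul, ← add_smul]
  congr 1
  ring

theorem xTrace_mem_K (d : D₃) : xTrace d ∈ K := by
  induction d using monomial_induction with
  | zero => rw [map_zero]; exact zero_mem _
  | add d e hd he => rw [map_add]; exact add_mem hd he
  | smul c d hd => rw [map_smul]; exact SMulMemClass.smul_mem c hd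
  | monomial i j =>
    rw [xTrace_monomial]
    by_cases hj : 3 ∣ j
    · rw [y_pow_eq, Nat.mod_eq_zero_of_dvd hj, pow_zero, mul_smul_comm, mul_one]
      exact SMulMemClass.smul_mem _ (SMulMemClass.smul_mem _ (pow_mem x_mem_K i))
    · rw [one_add_ε_pow_eq_zero hj, zero_mul, zero_smul]
      exact zero_mem _

/-- An element commuting with `x` is multiplied by `3a` under `xTrace`, whose values lie in `K`. -/
theorem centralizer_K : Set.centralizer (K : Set D₃) = K := by
  ext d
  refine ⟨fun h => ?_, fun hd k hk => congrArg Subtype.val (K_mul_comm ⟨k, hk⟩ ⟨d, hd⟩)⟩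
  rw [← inv_smul_smul₀ (three_mul_ne_zero a_ne_zero) d, ← xTrace_of_commute (h x x_mem_K)]
  exact SMulMemClass.smul_mem _ (xTrace_mem_K d)

/-- Only monomials with both exponents divisible by `3` survive the two traces, and these are
scalars. A central element is merely multiplied by `9ab`, hence is a scalar. -/
theorem yTrace_xTrace_mem_bot (d : D₃) : yTrace (xTrace d) ∈ (⊥ : Subalgebra RatFun D₃) := by
  induction d using monomial_induction with
  | zero => rw [map_zero, map_zero]; exact zero_mem _
  | add d e hd he => rw [map_add, map_add]; exact add_mem hd he
  | smul c d hd => rw [map_smul, map_smul]; exact Subalgebra.smul_mem _ hd c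
  | monomial i j =>
    rw [xTrace_monomial, map_smul, yTrace_monomial]
    by_cases hj : 3 ∣ j
    · by_cases hi : 3 ∣ i
      · rw [x_pow_eq, y_pow_eq, Nat.mod_eq_zero_of_dvd hj, Nat.mod_eq_zero_of_dvd hi, pow_zero,
          pow_zero, smul_mul_smul_comm, mul_one]
        exact Subalgebra.smul_mem _ (Subalgebra.smul_mem _ (Subalgebra.smul_mem _ (one_mem _) _) _) _
      · rw [one_add_ε_pow_eq_zero hi, zero_mul, zero_smul, smul_zero]
        exact zero_mem _
    · rw [one_add_ε_pow_eq_zero hj, zero_mul, zero_smul]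
      exact zero_mem _

instance : Algebra.IsCentral RatFun D₃ where
  out d hd := by
    have h := Subalgebra.mem_center_iff.1 hd
    have hx := xTrace_of_commute (h x)
    have hy := yTrace_of_commute (h y)
    have hxy := yTrace_xTrace_mem_bot d
    rw [hx, map_smul, hy] at hxy
    rw [← inv_smul_smul₀ (three_mul_ne_zero b_ne_zero) d,
      ← inv_smul_smul₀ (three_mul_ne_zero a_ne_zero) ((3 * b) • d)]
    exact Subalgebra.smul_mem _ (Subalgebra.smul_mem _ hxy _) _

end D₃

/-! ### An obstruction to formal reality. -/

/-- If `X` and `Z` are commuting fixed points of an involution with the same cube, then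
`(X * (X - Z) ^ 2) ^ 2 + 3 * (Z ^ 2 * (X - Z)) ^ 2 = 0`. -/
theorem not_isFormallyRealInvolution_of_pow_three_eq {R : Type*} [Ring R] [StarRing R] {X Z : R}
    (hXs : star X = X) (hZs : star Z = Z) (hXZ : Commute X Z) (hcube : X ^ 3 = Z ^ 3)
    (h3 : ∀ r : R, 3 * r = 0 → r = 0) (hne : (Z ^ 2 * (X - Z)) ^ 2 ≠ 0) :
    ¬ IsFormallyRealInvolution R := by
  intro h
  have hXW : Commute X (X - Z) := (Commute.refl X).sub_right hXZ
  have hZW : Commute Z (X - Z) := hXZ.symm.sub_right (Commute.refl Z)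
  have hr : Z ^ 2 * (X - Z) * star (Z ^ 2 * (X - Z)) = (Z ^ 2 * (X - Z)) ^ 2 := by
    rw [star_mul, star_sub, star_pow, hXs, hZs, ← (hZW.pow_left 2).eq, pow_two (Z ^ 2 * (X - Z))]
  have hs : X * (X - Z) ^ 2 * star (X * (X - Z) ^ 2) = (X * (X - Z) ^ 2) ^ 2 := by
    rw [star_mul, star_pow, star_sub, hXs, hZs, ← (hXW.pow_right 2).eq, pow_two (X * (X - Z) ^ 2)]
  -- With `u = X / Z` the two elements are `Z³ (u - 1)` and `Z³ (u - 1) · u (u - 1)`, and `u (u -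
  -- 1)` squares to `-3` where `u² + u + 1 = 0`. The powers of `Z` avoid inverses; the factor `u -
  -- 1` removes the part where `u = 1`.
  have hsum : 3 * (Z ^ 2 * (X - Z)) ^ 2 + (X * (X - Z) ^ 2) ^ 2 = 0 := by
    -- The identity involves only `X` and `Z`, so it can be verified in the commutative subring they
    -- generate.
    have hcomm := Algebra.isMulCommutative_adjoin ℤ (s := {X, Z}) (by
      rintro _ (rfl | rfl) _ (rfl | rfl)
      exacts [rfl, hXZ, hXZ.symm, rfl])
    let _ : CommRing (Algebra.adjoin ℤ {X, Z}) :=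
      { (inferInstance : Ring (Algebra.adjoin ℤ {X, Z})) with mul_comm := hcomm.is_comm.comm }
    let X' : Algebra.adjoin ℤ {X, Z} := ⟨X, Algebra.subset_adjoin (by simp)⟩
    let Z' : Algebra.adjoin ℤ {X, Z} := ⟨Z, Algebra.subset_adjoin (by simp)⟩
    have h' : X' ^ 3 = Z' ^ 3 := Subtype.ext hcube
    have : 3 * (Z' ^ 2 * (X' - Z')) ^ 2 + (X' * (X' - Z') ^ 2) ^ 2 = 0 := by
      linear_combination ((X' - Z') * (X' ^ 2 - 3 * X' * Z' + 3 * Z' ^ 2)) * h'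
    exact congrArg Subtype.val this
  have hs0 : (X * (X - Z) ^ 2) ^ 2 ≠ 0 := fun h0 =>
    hne (h3 _ (by rwa [h0, add_zero] at hsum))
  -- The coefficient `3` is realized by repeating the first element three times.
  refine h 4 ![Z ^ 2 * (X - Z), Z ^ 2 * (X - Z), Z ^ 2 * (X - Z), X * (X - Z) ^ 2] (by norm_num)
    ?_ ?_
  · intro i
    fin_cases i
    exacts [hr.trans_ne hne, hr.trans_ne hne, hr.trans_ne hne, hs.trans_ne hs0]
  · rw [Fin.sum_univ_four]
    refine Eq.trans ?_ hsum
    rw [← hs, ← hr]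
    simp only [Matrix.cons_val]
    noncomm_ring

/-! ### Splitting of `D₃` by `K`, and failure of formal reality. -/

namespace D₃

open RatFun Matrix

/-- The generator of `K`. -/
def xK : K := ⟨x, x_mem_K⟩

theorem xK_pow_three : xK ^ 3 = algebraMap RatFun K a :=
  Subtype.ext x_pow_three

instance : Nontrivial K := isField_K.nontrivial

instance : NoZeroDivisors K := inferInstanceAs (NoZeroDivisors (Algebra.adjoin RatFun {x}))

instance : FiniteDimensional RatFun K :=
  inferInstanceAs (FiniteDimensional RatFun (Algebra.adjoin RatFun {x}))

/-- The matrix `diag(1, ε², ε)`. -/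
def clock : Matrix (Fin 3) (Fin 3) K := diagonal fun i => algebraMap RatFun K (ε ^ (2 * (i : ℕ)))

/-- The matrix by which `x` acts on `K ^ 3`. -/
def xMatrix : Matrix (Fin 3) (Fin 3) K := scalar (Fin 3) xK * clock

/-- The matrix by which `y` acts on `K ^ 3`. -/
def yMatrix : Matrix (Fin 3) (Fin 3) K := !![0, 0, algebraMap RatFun K b; 1, 0, 0; 0, 1, 0]

theorem clock_pow_three : clock ^ 3 = 1 := by
  rw [clock, diagonal_pow, ← diagonal_one]
  congr 1
  ext1 i
  rw [Pi.pow_apply, ← map_pow, ← pow_mul, mul_comm, pow_mul, ε_pow_three, one_pow, map_one]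

theorem scalar_commute_of_K (k : K) (M : Matrix (Fin 3) (Fin 3) K) :
    Commute (scalar (Fin 3) k) M :=
  scalar_commute k (K_mul_comm k) M

theorem scalar_algebraMap (c : RatFun) :
    scalar (Fin 3) (algebraMap RatFun K c) = algebraMap RatFun (Matrix (Fin 3) (Fin 3) K) c := rfl

theorem xMatrix_pow_three : xMatrix ^ 3 = algebraMap RatFun _ a := by
  rw [xMatrix, (scalar_commute_of_K _ _).mul_pow, clock_pow_three, mul_one, ← map_pow, xK_pow_three,
    scalar_algebraMap]

theorem yMatrix_pow_three : yMatrix ^ 3 = algebraMap RatFun _ b := by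
  rw [← scalar_algebraMap, pow_succ, pow_two]
  ext i j : 1
  fin_cases i <;> fin_cases j <;>
    simp [yMatrix, Matrix.mul_apply, Fin.sum_univ_three, Algebra.algebraMap_eq_smul_one]

/-- `yMatrix` shifts the basis cyclically, so passing `clock` across it changes the eigenvalue `ε ^
(2 * i)` by `ε² = ε⁻¹`. This explains the exponent in `clock`. -/
theorem yMatrix_mul_clock : yMatrix * clock = algebraMap RatFun _ ε * (clock * yMatrix) := by
  have h3 : algebraMap RatFun K ε ^ 3 = 1 := by rw [← map_pow, ε_pow_three, map_one]
  have h4 : algebraMap RatFun K ε * algebraMap RatFun K ε ^ 2 = 1 := by rw [← pow_succ', h3]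
  have h5 : algebraMap RatFun K ε ^ 4 = algebraMap RatFun K ε := by rw [pow_succ, h3, one_mul]
  rw [← scalar_algebraMap]
  ext i j : 1
  fin_cases i <;> fin_cases j <;>
    simp [yMatrix, clock, h4, h5, ← pow_two, Algebra.commutes b (algebraMap RatFun K ε)]

theorem yMatrix_mul_xMatrix : yMatrix * xMatrix = algebraMap RatFun _ ε * (xMatrix * yMatrix) := by
  rw [xMatrix, mul_assoc, ← mul_assoc, ← (scalar_commute_of_K _ _).eq, mul_assoc,
    yMatrix_mul_clock, Algebra.left_comm]

/-- The representation of `D₃` on `K ^ 3`. -/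
def matrixRep : D₃ →ₐ[RatFun] Matrix (Fin 3) (Fin 3) K :=
  SymbolAlgebra.lift xMatrix_pow_three yMatrix_pow_three yMatrix_mul_xMatrix

theorem matrixRep_x : matrixRep x = xMatrix := SymbolAlgebra.lift_x _ _ _

theorem matrixRep_y : matrixRep y = yMatrix := SymbolAlgebra.lift_y _ _ _

/-- The extension of the representation of `D₃` on `K ^ 3` to `D₃ ⊗ K`. -/
def splitting : D₃ ⊗[RatFun] K →ₐ[RatFun] Matrix (Fin 3) (Fin 3) K :=
  Algebra.TensorProduct.lift matrixRep (scalarAlgHom (Fin 3) RatFun)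
    fun d k => (scalar_commute_of_K k (matrixRep d)).symm

theorem splitting_tmul (d : D₃) (k : K) :
    splitting (d ⊗ₜ k) = matrixRep d * scalar (Fin 3) k :=
  Algebra.TensorProduct.lift_tmul _ _ _ _ _

theorem scalar_mem_range (k : K) : scalar (Fin 3) k ∈ splitting.range :=
  (AlgHom.mem_range _).2 ⟨1 ⊗ₜ k, by rw [splitting_tmul, map_one, one_mul]⟩

theorem matrixRep_mem_range (d : D₃) : matrixRep d ∈ splitting.range :=
  (AlgHom.mem_range _).2 ⟨d ⊗ₜ 1, by rw [splitting_tmul, map_one, mul_one]⟩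

/-- `clock` is the image of `x ⊗ x⁻¹`, where `x⁻¹ = a⁻¹ x²`. -/
theorem clock_mem_range : clock ∈ splitting.range := by
  have h : a • clock = scalar (Fin 3) (xK ^ 2) * xMatrix := by
    rw [xMatrix, ← mul_assoc, ← map_mul, ← pow_succ, xK_pow_three, scalar_algebraMap,
      Algebra.smul_def]
  rw [← inv_smul_smul₀ a_ne_zero clock, h, ← matrixRep_x]
  exact Subalgebra.smul_mem _ (mul_mem (scalar_mem_range _) (matrixRep_mem_range _)) _

/-- Fourier inversion on `ℤ/3`: the diagonal matrix units are the spectral projections of `clock`.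
-/
theorem three_smul_single (j : Fin 3) : (3 : RatFun) • single j j (1 : K) =
    1 + ε ^ (j : ℕ) • clock + ε ^ (2 * (j : ℕ)) • clock ^ 2 := by
  rw [clock, diagonal_pow, ← diagonal_one, ← diagonal_smul, ← diagonal_smul, diagonal_add,
    diagonal_add, ← diagonal_single, ← diagonal_smul]
  congr 1
  ext1 i
  simp only [Pi.smul_apply, Pi.pow_apply, ← map_pow, Algebra.smul_def, ← map_mul]
  rw [← map_one (algebraMap RatFun K), ← map_add, ← map_add]
  have h : 1 + ε ^ (j : ℕ) * ε ^ (2 * (i : ℕ)) + ε ^ (2 * (j : ℕ)) * (ε ^ (2 * (i : ℕ))) ^ 2 =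
      1 + ε ^ ((j : ℕ) + 2 * i) + ε ^ (2 * ((j : ℕ) + 2 * i)) := by ring
  rw [h]
  -- Modulo `3` the exponent `j + 2i` is `j - i`, so it is divisible by `3` exactly when `i = j`.
  by_cases hij : i = j
  · subst hij
    rw [one_add_ε_pow_eq_three ⟨i, by ring⟩, Pi.single_eq_same, map_one, mul_one]
  · rw [one_add_ε_pow_eq_zero (by omega), Pi.single_eq_of_ne hij, map_zero, mul_zero]

theorem single_diag_mem_range (j : Fin 3) (k : K) : single j j k ∈ splitting.range := by
  have h : single j j k = scalar (Fin 3) k * single j j 1 := by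
    ext r s : 1
    simp [scalar_apply, single_apply]
  rw [h, ← inv_smul_smul₀ (show (3 : RatFun) ≠ 0 by norm_num) (single j j (1 : K)),
    three_smul_single]
  exact mul_mem (scalar_mem_range k) (Subalgebra.smul_mem _ (add_mem (add_mem (one_mem _)
    (Subalgebra.smul_mem _ clock_mem_range _))
    (Subalgebra.smul_mem _ (pow_mem clock_mem_range 2) _)) _)

theorem yMatrix_mul_single (i j : Fin 3) (k : K) : yMatrix * single i j k =
    single (i + 1) j (if i = 2 then algebraMap RatFun K b * k else k) := by
  ext r s : 1
  fin_cases i <;> fin_cases r <;>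
    simp [yMatrix, Matrix.mul_apply, Fin.sum_univ_three, single_apply]

/-- Multiplication by `yMatrix` moves a matrix unit one row down; the factor `b` picked up on
wrapping around is compensated in advance by `b⁻¹`. -/
theorem single_succ_mem_range {i j : Fin 3} (h : ∀ k, single i j k ∈ splitting.range) (k : K) :
    single (i + 1) j k ∈ splitting.range := by
  have hmem : ∀ k, yMatrix * single i j k ∈ splitting.range := fun k =>
    mul_mem (matrixRep_y ▸ matrixRep_mem_range y) (h k)
  by_cases hi : i = 2
  · have := hmem (algebraMap RatFun K b⁻¹ * k)
    rwa [yMatrix_mul_single, if_pos hi, ← mul_assoc, ← map_mul, mul_inv_cancel₀ b_ne_zero, map_one,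
      one_mul] at this
  · have := hmem k
    rwa [yMatrix_mul_single, if_neg hi] at this

theorem single_mem_range (i j : Fin 3) (k : K) : single i j k ∈ splitting.range := by
  have h0 := single_diag_mem_range j
  have h1 := single_succ_mem_range h0
  have hij : ∀ i j : Fin 3, i = j ∨ i = j + 1 ∨ i = j + 1 + 1 := by decide
  rcases hij i j with rfl | rfl | rfl
  exacts [h0 k, h1 k, single_succ_mem_range h1 k]

theorem splitting_surjective : Function.Surjective splitting := fun M => by
  change M ∈ splitting.range
  rw [matrix_eq_sum_single M]
  exact sum_mem fun i _ => sum_mem fun j _ => single_mem_range i j _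

/-- Surjectivity of `splitting` gives `9 [K : F] ≤ dim D₃ · [K : F]`. Neither independence of the
nine monomials over `F` nor the value of `[K : F]` is needed. -/
theorem finrank_eq : Module.finrank RatFun D₃ = 9 := by
  refine le_antisymm finrank_le ?_
  have h := LinearMap.finrank_le_finrank_of_surjective (f := splitting.toLinearMap)
    splitting_surjective
  rw [Module.finrank_matrix, Module.finrank_tensorProduct, Fintype.card_fin] at h
  exact Nat.le_of_mul_le_mul_right h Module.finrank_pos

theorem splitting_bijective : Function.Bijective splitting := by
  have h : Module.finrank RatFun (D₃ ⊗[RatFun] K) =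
      Module.finrank RatFun (Matrix (Fin 3) (Fin 3) K) := by
    rw [Module.finrank_matrix, Module.finrank_tensorProduct, Fintype.card_fin, finrank_eq]
  have hinj : Function.Injective splitting.toLinearMap :=
    (LinearMap.injective_iff_surjective_of_finrank_eq_finrank (V := D₃ ⊗[RatFun] K)
      (V₂ := Matrix (Fin 3) (Fin 3) K) h).2 splitting_surjective
  exact ⟨hinj, splitting_surjective⟩

theorem not_isFormallyRealInvolution_tensorProduct :
    ¬ IsFormallyRealInvolution (D₃ ⊗[RatFun] K) := by
  refine not_isFormallyRealInvolution_of_pow_three_eq (X := x ⊗ₜ 1) (Z := 1 ⊗ₜ xK) ?_ ?_ ?_ ?_ ?_ ?_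
  · rw [TensorProduct.star_tmul, star_x, star_one]
  · rw [TensorProduct.star_tmul, star_one]
    exact congrArg _ (Subtype.ext star_x)
  · rw [commute_iff_eq, Algebra.TensorProduct.tmul_mul_tmul,
      Algebra.TensorProduct.tmul_mul_tmul, one_mul, one_mul, mul_one, mul_one]
  · rw [Algebra.TensorProduct.tmul_pow, Algebra.TensorProduct.tmul_pow, one_pow, one_pow,
      x_pow_three, xK_pow_three, Algebra.algebraMap_eq_smul_one, Algebra.algebraMap_eq_smul_one,
      TensorProduct.smul_tmul]
  · intro r hr
    rw [← map_ofNat (algebraMap RatFun (D₃ ⊗[RatFun] K)), ← Algebra.smul_def] at hr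
    exact (smul_eq_zero_iff_right (by norm_num)).1 hr
  · intro h0
    have h1 := congrArg splitting h0
    -- The element to be shown nonzero maps to `(a (clock - 1))²`, a diagonal matrix.
    have hsplit : scalar (Fin 3) xK ^ 2 * (xMatrix - scalar (Fin 3) xK) = a • (clock - 1) := by
      rw [xMatrix, ← mul_sub_one, ← mul_assoc, ← pow_succ, ← map_pow, xK_pow_three,
        scalar_algebraMap, Algebra.smul_def]
    rw [map_pow, map_mul, map_pow, map_sub, splitting_tmul, splitting_tmul, map_one, map_one,
      mul_one, one_mul, matrixRep_x, hsplit, map_zero, smul_pow,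
      smul_eq_zero_iff_right (pow_ne_zero 2 a_ne_zero), clock, ← diagonal_one,
      diagonal_sub, diagonal_pow] at h1
    -- The entry at `0` vanishes, whereas at `1` the eigenvalue of `clock` is `ε² ≠ 1`.
    have h2 := congrFun (congrFun h1 1) 1
    rw [diagonal_apply_eq, Matrix.zero_apply, Pi.pow_apply, sq_eq_zero_iff, sub_eq_zero,
      ← map_one (algebraMap RatFun K)] at h2
    have h3 : ε ^ 2 = 1 := (algebraMap RatFun K).injective h2
    refine ε_ne_one ?_
    linear_combination ε_pow_three - ε * h3

end D₃

/-! ### `K` is Galois over `F`, and the general counterexample. -/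

namespace RatFun

open Polynomial

/-- An extension of `ℂ(a, b)` generated by a cube root of `a` is a Galois extension. -/
theorem isGalois_of_pow_three_eq {L : Type*} [Field L] [Algebra RatFun L] {z : L}
    (hz : z ^ 3 = algebraMap RatFun L a) (hgen : Algebra.adjoin RatFun {z} = ⊤) :
    IsGalois RatFun L := by
  have hsep : (X ^ 3 - C a : RatFun[X]).Separable :=
    separable_X_pow_sub_C a (by norm_num) a_ne_zero
  have hε : algebraMap RatFun L ε ^ 2 + algebraMap RatFun L ε + 1 = 0 := by
    rw [← map_pow, ← map_add, ← map_one (algebraMap RatFun L), ← map_add, ε_sq, map_zero]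
  have hsplit : IsSplittingField RatFun L (X ^ 3 - C a : RatFun[X]) := by
    refine ⟨?_, ?_⟩
    -- The base field contains `ε`, so the other two cube roots `ε z` and `ε² z` of `a` already lie
    -- in `L`.
    · have : (X ^ 3 - C a : RatFun[X]).map (algebraMap RatFun L) = (X - C z) *
          (X - C (algebraMap RatFun L ε * z)) * (X - C (algebraMap RatFun L ε ^ 2 * z)) := by
        have hC : (C (algebraMap RatFun L ε) ^ 2 + C (algebraMap RatFun L ε) + 1 : L[X]) = 0 := by
          rw [← C_pow, ← C_add, ← C_1, ← C_add, hε, C_0]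
        have h3 : (C (algebraMap RatFun L a) : L[X]) = C z ^ 3 := by rw [← hz, C_pow]
        simp only [Polynomial.map_sub, Polynomial.map_pow, map_X, map_C, h3, C_mul, C_pow]
        linear_combination (C z * X ^ 2 - C (algebraMap RatFun L ε) * C z ^ 2 * X +
          (C (algebraMap RatFun L ε) - 1) * C z ^ 3) * hC
      rw [this]
      exact ((Splits.X_sub_C _).mul (Splits.X_sub_C _)).mul (Splits.X_sub_C _)
    · refine top_le_iff.1 (hgen.symm.trans_le (Algebra.adjoin_mono ?_))
      rw [Set.singleton_subset_iff, mem_rootSet_of_ne hsep.ne_zero]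
      simp [hz]
  exact IsGalois.of_separable_splitting_field hsep

end RatFun

namespace D₃

open RatFun

theorem adjoin_xK : Algebra.adjoin RatFun {xK} = ⊤ := by
  have h := Subalgebra.map_injective (f := K.toSubalgebra.val) Subtype.val_injective
  refine h ?_
  rw [AlgHom.map_adjoin, Set.image_singleton, Algebra.map_top, Subalgebra.range_val]
  rfl

/-- `D₃` as a division ring. -/
abbrev divisionRing : DivisionRing D₃ :=
  DivisionRing.ofIsUnitOrEqZero fun d =>
    (em (d = 0)).elim Or.inr fun h => Or.inl (isUnit_of_ne_zero h)

/-- `K` as a field. -/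
abbrev fieldK : Field K := isField_K.toField

theorem isGalois_K : letI := fieldK; IsGalois RatFun K :=
  letI := fieldK
  isGalois_of_pow_three_eq (z := xK) xK_pow_three adjoin_xK

theorem range_subtype_K : Set.range K.subtype = (K : Set D₃) := Subtype.range_coe

theorem not_forall_isFormallyRealInvolution_tensorProduct :
    ¬ ∀ (F D K : Type) [Field F] [CharZero F] [StarRing F]
        [DivisionRing D] [Algebra F D] [StarRing D] [StarModule F D]
        [Algebra.IsCentral F D] [FiniteDimensional F D]
        [Field K] [Algebra F K] [StarRing K] [StarModule F K] [IsGalois F K]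
        (j : K →⋆ₐ[F] D),
        Set.centralizer (Set.range j) = Set.range j →
        IsFormallyRealInvolution D →
        IsFormallyRealInvolution (D ⊗[F] K) := fun h =>
  letI := divisionRing
  letI := fieldK
  haveI := isGalois_K
  not_isFormallyRealInvolution_tensorProduct <|
    h RatFun D₃ K K.subtype (by rw [range_subtype_K]; exact centralizer_K)
      isFormallyRealInvolution

end D₃

end

theorem mainTheorem9 :
    -- `D₃` is a central division algebra of degree `3` over `F = ℂ(a, b)`
    (Algebra.IsCentral RatFun D₃ ∧ Module.finrank RatFun D₃ = 9 ∧
      ∀ d : D₃, d ≠ 0 → IsUnit d) ∧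
    -- its involution fixes `a`, `b`, `x`, `y` and conjugates `ℂ`
    (star D₃.x = D₃.x ∧ star D₃.y = D₃.y ∧
        (star (algebraMap RatFun D₃ RatFun.a) = algebraMap RatFun D₃ RatFun.a) ∧
        (star (algebraMap RatFun D₃ RatFun.b) = algebraMap RatFun D₃ RatFun.b) ∧
        ∀ z : ℂ, star (algebraMap RatFun D₃ (algebraMap ℂ RatFun z)) =
          algebraMap RatFun D₃ (algebraMap ℂ RatFun (starRingEnd ℂ z))) ∧
    -- `K = F(x)` is a maximal subfield of `D₃`
    (IsField D₃.K ∧ Set.centralizer (D₃.K : Set D₃) = D₃.K) ∧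
    -- `D₃` is formally real
    IsFormallyRealInvolution D₃ ∧
    -- `D₃ ⊗ K ≅ M₃(K)` as `K`-algebras
    (∃ φ : D₃ ⊗[RatFun] D₃.K ≃ₐ[RatFun] Matrix (Fin 3) (Fin 3) D₃.K,
      ∀ k : D₃.K, φ (1 ⊗ₜ[RatFun] k) = Matrix.scalar (Fin 3) k) ∧
    -- `D₃ ⊗ K` with `star (d ⊗ k) = star d ⊗ star k` is not formally real
    ¬ IsFormallyRealInvolution (D₃ ⊗[RatFun] D₃.K) ∧
    -- formal reality of a central division algebra does not pass to its scalar extension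
    -- by a maximal subfield which is invariant under the involution and Galois over the center
    ¬ ∀ (F D K : Type) [Field F] [CharZero F] [StarRing F]
        [DivisionRing D] [Algebra F D] [StarRing D] [StarModule F D]
        [Algebra.IsCentral F D] [FiniteDimensional F D]
        [Field K] [Algebra F K] [StarRing K] [StarModule F K] [IsGalois F K]
        (j : K →⋆ₐ[F] D),
        Set.centralizer (Set.range j) = Set.range j →
        IsFormallyRealInvolution D →
        IsFormallyRealInvolution (D ⊗[F] K) := by
  exact ⟨⟨inferInstance, D₃.finrank_eq, fun _ => D₃.isUnit_of_ne_zero⟩,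
    ⟨D₃.star_x, D₃.star_y, by rw [D₃.star_algebraMap, RatFun.star_a],
      by rw [D₃.star_algebraMap, RatFun.star_b],
      fun z => by rw [D₃.star_algebraMap, RatFun.star_algebraMap_complex]⟩,
    ⟨D₃.isField_K, D₃.centralizer_K⟩,
    D₃.isFormallyRealInvolution,
    ⟨AlgEquiv.ofBijective D₃.splitting D₃.splitting_bijective, fun k => by
      rw [AlgEquiv.coe_ofBijective, D₃.splitting_tmul, map_one, one_mul]⟩,
    D₃.not_isFormallyRealInvolution_tensorProduct,
    D₃.not_forall_isFormallyRealInvolution_tensorProduct⟩
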